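/- Let $L$ be a frame, with pseudocomplement written $a^*$. Let $CL$ be the Boolean algebra of complemented elements of $L$, with the order of $L$, and $\mathfrak{B}L=\{x\in L : x^{**}=x\}$ the Booleanization of $L$. The frame $L$ is *extremally disconnected* (ED) if $a^*\vee a^{**}=1$ for all $a\in L$, and *zero-dimensional* if every element of $L$ is the join of the complemented elements below it. For a meet-semilattice $A$, let $\mathcal{D}A$ be the frame of downsets of $A$. A subset $G\subseteq A$ is *admissible* if $\bigvee G$ exists in $A$ and, for every $a\in A$, $\bigvee\{a\wedge y : y\in G\}$ exists in $A$ and equals $a\wedge\bigvee G$. Let $D_\infty A\subseteq\mathcal{D}A$ be the set of *D-ideals* of $A$, i.e. of those downsets $E$ such that $\bigvee G\in E$ for every admissible $G\subseteq E$. For $a,b\in L$ write $a\prec b$ if $a^*\vee b=1$, and $a\prec\!\!\prec b$ if there are elements $c_r\in L$ ($r\in\mathbb{Q}\cap[0,1]$) with $c_0=a$, $c_1=b$ and $c_r\prec c_s$ whenever $r<s$. Let $\mathrm{Coz}\,L$ be the set of all $a=\bigvee_{n\in\mathbb{N}}a_n$ with $a_n\prec\!\!\prec a_{n+1}$ for all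 $n$. Let $\lambda L$ (the Lindelöf coreflection) be the frame, under inclusion, of $\sigma$-ideals of $\mathrm{Coz}\,L$, i.e. of downsets of $\mathrm{Coz}\,L$ closed under countable joins, including the empty join. Let $\beta L$ (the Stone–Čech compactification) be the frame, under inclusion, of regular ideals of $L$, i.e. of nonempty ideals $I$ of $L$ such that for every $a\in I$ there is $b\in I$ with $a\prec\!\!\prec b$. **Theorem.** Let $L$ be a zero-dimensional frame. The following are equivalent. 1. $L$ is ED. 2. $CL$ is a frame. 3. $CL=D_\infty CL=\mathfrak{B}L$, as subsets of $\mathcal{D}(CL)$, where $CL$ is identified with the set of principal downsets $\{{\downarrow}c : c\in CL\}$, and $x\in L$ with the downset $\{c\in CL : c\le x\}$. 4. $CL$ is a complete Boolean algebra. 5. The embedding $CL\hookrightarrow L$ has a left adjoint (as a map of posets). 6. $\lambda L$ is ED. 7. $\beta L$ is ED. -/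

import Mathlib

universe u

namespace PointfreeED

section Basic

variable (L : Type u) [Order.Frame L]

/-- A frame is extremally disconnected if `a* ⊔ a** = ⊤` for every `a`
(`aᶜ` is the pseudocomplement of `a`). -/
def IsED : Prop := ∀ a : L, aᶜ ⊔ aᶜᶜ = ⊤

/-- A frame is zero-dimensional if its complemented elements form a base, i.e. every element is the
join of the complemented elements below it. -/
def IsZeroDimensional : Prop := ∀ x : L, IsLUB {c : L | IsComplemented c ∧ c ≤ x} x

end Basic

section Posets

/-- The poset `A`, with its given order, is a frame. -/
def IsFrame (A : Type u) [PartialOrder A] : Prop :=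
  ∃ (F : Type u) (_ : Order.Frame F), Nonempty (A ≃o F)

/-- The poset `A`, with its given order, is a complete Boolean algebra. -/
def IsCompleteBoolean (A : Type u) [PartialOrder A] : Prop :=
  ∃ (B : Type u) (_ : CompleteBooleanAlgebra B), Nonempty (A ≃o B)

/-- `s` is the join of `G` in the meet-semilattice `A`, and every `a ⊓ s` is the join of the
`a ⊓ y`, `y ∈ G`. So `G` is admissible with join `s`. -/
def IsAdmissibleJoin {A : Type u} [SemilatticeInf A] (G : Set A) (s : A) : Prop :=
  IsLUB G s ∧ ∀ a : A, IsLUB ((fun y => a ⊓ y) '' G) (a ⊓ s)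

/-- The D-ideals of a meet-semilattice: the downsets closed under joins of admissible subsets.
This is `D_∞ A`, as a subset of the frame of downsets of `A`. -/
def DInfty (A : Type u) [SemilatticeInf A] : Set (LowerSet A) :=
  {E | ∀ (G : Set A) (s : A), G ⊆ (E : Set A) → IsAdmissibleJoin G s → s ∈ E}

/-- The copy of a meet-semilattice `A` in its frame of downsets: the principal downsets. -/
def principalDownsets (A : Type u) [SemilatticeInf A] : Set (LowerSet A) :=
  Set.range (LowerSet.Iic : A → LowerSet A)

end Posets

section Center

variable (L : Type u) [Order.Frame L]

/-- The embedding of `L` into the frame of downsets of the lattice `CL` of its complemented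
elements, sending `x` to the downset of the complemented elements below `x`. If `CL` is a base of
`L`, then this identifies `L` with a sublocale of the frame of downsets of `CL`. -/
def toDownsets (x : L) : LowerSet (Complementeds L) where
  carrier := {c | (c : L) ≤ x}
  lower' := fun _ _ hba ha => le_trans (Subtype.coe_le_coe.mpr hba) ha

/-- The Booleanization `{x | x** = x}` of `L`. -/
def booleanization : Set L := {x | xᶜᶜ = x}

end Center

section CompletelyBelow

variable {L : Type u} [Order.Frame L]

/-- `a` is rather below `b`: `a* ⊔ b = ⊤`. -/
def RatherBelow (a b : L) : Prop := aᶜ ⊔ b = ⊤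

/-- `a` is completely below `b`: there is a family of elements indexed by the rationals of `[0,1]`
that goes from `a` to `b` and is strictly increasing for the rather below relation. -/
def CompletelyBelow (a b : L) : Prop :=
  ∃ c : ℚ → L, c 0 = a ∧ c 1 = b ∧ ∀ p q : ℚ, 0 ≤ p → p < q → q ≤ 1 → RatherBelow (c p) (c q)

theorem RatherBelow.mono {a b x y : L} (h : RatherBelow a b) (hx : x ≤ a) (hy : b ≤ y) :
    RatherBelow x y :=
  top_le_iff.mp (le_trans h.ge (sup_le_sup (compl_le_compl hx) hy))

theorem RatherBelow.sup {a b c d : L} (h : RatherBelow a b) (h' : RatherBelow c d) :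
    RatherBelow (a ⊔ c) (b ⊔ d) := by
  unfold RatherBelow at *
  rw [compl_sup, sup_inf_right, ← sup_assoc, h, sup_comm b d, ← sup_assoc, h']
  simp

theorem RatherBelow.inf {a b c d : L} (h : RatherBelow a b) (h' : RatherBelow c d) :
    RatherBelow (a ⊓ c) (b ⊓ d) := by
  have h1 := h.mono (inf_le_left : a ⊓ c ≤ a) le_rfl
  have h2 := h'.mono (inf_le_right : a ⊓ c ≤ c) le_rfl
  unfold RatherBelow at *
  rw [sup_inf_left, h1, h2, inf_top_eq]

theorem CompletelyBelow.mono {a b x y : L} (h : CompletelyBelow a b) (hx : x ≤ a) (hy : b ≤ y) :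
    CompletelyBelow x y := by
  obtain ⟨c, rfl, rfl, hc⟩ := h
  refine ⟨fun p => if p = 0 then x else if p = 1 then y else c p, by simp, by simp, ?_⟩
  intro p q hp hpq hq
  refine (hc p q hp hpq hq).mono ?_ ?_
  · have : p ≠ 1 := (lt_of_lt_of_le hpq hq).ne
    by_cases h0 : p = 0
    · subst h0; simpa using hx
    · simp [h0, this]
  · have : q ≠ 0 := (lt_of_le_of_lt hp hpq).ne'
    by_cases h1 : q = 1
    · subst h1; simpa using hy
    · simp [h1, this]

theorem CompletelyBelow.sup {a b c d : L} (h : CompletelyBelow a b) (h' : CompletelyBelow c d) :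
    CompletelyBelow (a ⊔ c) (b ⊔ d) := by
  obtain ⟨f, rfl, rfl, hf⟩ := h
  obtain ⟨g, rfl, rfl, hg⟩ := h'
  exact ⟨fun p => f p ⊔ g p, rfl, rfl, fun p q h0 h1 h2 => (hf p q h0 h1 h2).sup (hg p q h0 h1 h2)⟩

theorem CompletelyBelow.inf {a b c d : L} (h : CompletelyBelow a b) (h' : CompletelyBelow c d) :
    CompletelyBelow (a ⊓ c) (b ⊓ d) := by
  obtain ⟨f, rfl, rfl, hf⟩ := h
  obtain ⟨g, rfl, rfl, hg⟩ := h'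
  exact ⟨fun p => f p ⊓ g p, rfl, rfl, fun p q h0 h1 h2 => (hf p q h0 h1 h2).inf (hg p q h0 h1 h2)⟩

theorem RatherBelow.le {a b : L} (h : RatherBelow a b) : a ≤ b := by
  have h1 : a ⊓ (aᶜ ⊔ b) = a := by rw [h, inf_top_eq]
  rw [inf_sup_left, inf_compl_self, bot_sup_eq] at h1
  exact inf_eq_left.mp h1

theorem CompletelyBelow.le {a b : L} (h : CompletelyBelow a b) : a ≤ b := by
  obtain ⟨c, rfl, rfl, hc⟩ := h
  exact (hc 0 1 le_rfl one_pos le_rfl).le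

theorem completelyBelow_bot : CompletelyBelow (⊥ : L) ⊥ :=
  ⟨fun _ => ⊥, rfl, rfl, fun _ _ _ _ _ => by simp [RatherBelow]⟩

end CompletelyBelow

section Lindelof

variable {L : Type u} [Order.Frame L]

/-- Cozero elements: joins of sequences, each term completely below the next one. -/
def IsCozero (a : L) : Prop :=
  ∃ s : ℕ → L, (∀ n, CompletelyBelow (s n) (s (n + 1))) ∧ a = ⨆ n, s n

theorem IsCozero.inf {a b : L} (ha : IsCozero a) (hb : IsCozero b) : IsCozero (a ⊓ b) := by
  obtain ⟨s, hs, rfl⟩ := ha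
  obtain ⟨t, ht, rfl⟩ := hb
  refine ⟨fun n => s n ⊓ t n, fun n => (hs n).inf (ht n), ?_⟩
  exact (iSup_inf_of_monotone (monotone_nat_of_le_succ fun n => (hs n).le)
    (monotone_nat_of_le_succ fun n => (ht n).le)).symm

/-- Cozero elements are closed under countable joins. -/
theorem IsCozero.iSup {s : ℕ → L} (h : ∀ n, IsCozero (s n)) : IsCozero (⨆ n, s n) := by
  choose t ht e using h
  refine ⟨fun n => (Finset.range n).sup fun m => t m n, fun n => ?_, ?_⟩
  · have key : ∀ k, CompletelyBelow ((Finset.range k).sup fun m => t m n)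
        ((Finset.range k).sup fun m => t m (n + 1)) := by
      intro k
      induction k with
      | zero => simpa using completelyBelow_bot
      | succ k ih =>
        rw [Finset.range_add_one, Finset.sup_insert, Finset.sup_insert]
        exact (ht _ _).sup ih
    exact (key n).mono le_rfl (Finset.sup_mono (by simp))
  · apply le_antisymm
    · refine iSup_le fun m => ?_
      rw [e]
      have hm := monotone_nat_of_le_succ fun n => (ht m n).le
      refine iSup_le fun n => le_trans (hm (le_max_left n (m + 1))) ?_
      refine le_trans ?_ (le_iSup _ (max n (m + 1)))
      exact Finset.le_sup (f := fun k => t k (max n (m + 1))) (by simp)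
    · refine iSup_le fun n => Finset.sup_le fun m _ => le_trans ?_ (le_iSup _ m)
      rw [e]
      exact le_iSup (t m) n

variable (L)

/-- `Coz L`, with the order of `L`. -/
abbrev Coz : Type u := {a : L // IsCozero a}

variable {L}

/-- A σ-ideal of `Coz L` is a downset of `Coz L` that is closed under countable joins
(including the empty one). Countable joins in `Coz L` are computed in `L`. -/
def IsSigmaIdeal (E : LowerSet (Coz L)) : Prop :=
  ∀ S : Set (Coz L), S.Countable → S ⊆ (E : Set (Coz L)) →
    ∀ c : Coz L, (c : L) = sSup (Subtype.val '' S) → c ∈ E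

theorem IsSigmaIdeal.himp {E H : LowerSet (Coz L)} (hH : IsSigmaIdeal H) :
    IsSigmaIdeal (E ⇨ H) := by
  intro S hS hSE c hc
  suffices h : LowerSet.Iic c ≤ E ⇨ H from h (LowerSet.mem_Iic_iff.mpr le_rfl)
  rw [le_himp_iff]
  rintro y ⟨hyc, hyE⟩
  have hyc' : (y : L) ≤ c := hyc
  refine hH ((fun s : Coz L => ⟨(y : L) ⊓ s, y.2.inf s.2⟩) '' S) (hS.image _) ?_ y ?_
  · rintro _ ⟨s, hs, rfl⟩
    have h1 : (E ⇨ H) ⊓ E ≤ H := himp_inf_le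
    exact h1 ⟨(E ⇨ H).lower (show (⟨(y : L) ⊓ s, y.2.inf s.2⟩ : Coz L) ≤ s from inf_le_right)
      (hSE hs), E.lower (show (⟨(y : L) ⊓ s, y.2.inf s.2⟩ : Coz L) ≤ y from inf_le_left) hyE⟩
  · rw [Set.image_image]
    rw [hc] at hyc'
    conv_lhs => rw [← inf_eq_left.mpr hyc', inf_sSup_eq]
    rw [sSup_image, iSup_image]

variable (L)

/-- The Lindelöf coreflection `λL`: the frame of σ-ideals of `Coz L`, ordered by inclusion
(presented as a sublocale of the frame of downsets of `Coz L`). -/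
def lindelof : Sublocale (LowerSet (Coz L)) where
  carrier := {E | IsSigmaIdeal E}
  sInf_mem' := by
    intro T hT S hS hST c hc
    rw [LowerSet.mem_sInf_iff]
    intro E hE
    exact hT hE S hS (fun x hx => LowerSet.mem_sInf_iff.mp (hST hx) E hE) c hc
  himp_mem' := fun _ _ hH => IsSigmaIdeal.himp hH

end Lindelof

section StoneCech

variable {L : Type u} [Order.Frame L]

/-- A (nonempty) ideal is regular if each of its elements is completely below one of its
elements. -/
def IsRegularIdeal (I : Order.Ideal L) : Prop :=
  ∀ a ∈ I, ∃ b ∈ I, CompletelyBelow a b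

/-- The ideal of all elements completely below some element of `I`. -/
def regularPart (I : Order.Ideal L) : Order.Ideal L where
  carrier := {a | ∃ b ∈ I, CompletelyBelow a b}
  lower' := fun _ _ h ⟨d, hd, hbd⟩ => ⟨d, hd, hbd.mono h le_rfl⟩
  nonempty' := ⟨⊥, ⊥, I.bot_mem, completelyBelow_bot⟩
  directed' := fun a ⟨c, hc, hac⟩ b ⟨d, hd, hbd⟩ =>
    ⟨a ⊔ b, ⟨c ⊔ d, Order.Ideal.sup_mem hc hd, hac.sup hbd⟩, le_sup_left, le_sup_right⟩

/-- Relative pseudocomplement of ideals. -/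
def idealHimp (I J : Order.Ideal L) : Order.Ideal L where
  carrier := {a | ∀ b ∈ I, a ⊓ b ∈ J}
  lower' := fun _ _ h ha b hb => J.lower (inf_le_inf_right b h) (ha b hb)
  nonempty' := ⟨⊥, fun b _ => by simp⟩
  directed' := fun a ha b hb => ⟨a ⊔ b, fun c hc => by
    rw [inf_sup_right]
    exact Order.Ideal.sup_mem (ha c hc) (hb c hc), le_sup_left, le_sup_right⟩

theorem le_idealHimp_iff {I J K : Order.Ideal L} : K ≤ idealHimp I J ↔ I ⊓ K ≤ J := by
  constructor
  · intro h x hx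
    simpa using h hx.2 x hx.1
  · intro h x hx b hb
    exact h ⟨I.lower inf_le_right hb, K.lower inf_le_left hx⟩

theorem isRegularIdeal_sSup {S : Set (Order.Ideal L)} (hS : ∀ I ∈ S, IsRegularIdeal I) :
    IsRegularIdeal (sSup S) := by
  have h : sSup S ≤ regularPart (sSup S) := sSup_le fun I hI a ha => by
    obtain ⟨b, hb, hab⟩ := hS I hI a ha
    exact ⟨b, le_sSup hI hb, hab⟩
  exact fun a ha => h ha

theorem IsRegularIdeal.inf {I J : Order.Ideal L} (hI : IsRegularIdeal I) (hJ : IsRegularIdeal J) :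
    IsRegularIdeal (I ⊓ J) := by
  rintro a ⟨haI, haJ⟩
  obtain ⟨b, hb, hab⟩ := hI a haI
  obtain ⟨c, hc, hac⟩ := hJ a haJ
  exact ⟨b ⊓ c, ⟨I.lower inf_le_left hb, J.lower inf_le_right hc⟩,
    (hab.inf hac).mono (le_inf le_rfl le_rfl) le_rfl⟩

variable (L)

/-- The Stone–Čech compactification `βL`: the regular ideals of `L`, ordered by inclusion. -/
abbrev StoneCechFrame : Type u := {I : Order.Ideal L // IsRegularIdeal I}

noncomputable instance : SupSet (StoneCechFrame L) where
  sSup S := ⟨sSup (Subtype.val '' S), isRegularIdeal_sSup (by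
    rintro _ ⟨I, _, rfl⟩
    exact I.2)⟩

noncomputable instance : CompleteLattice (StoneCechFrame L) where
  __ := Subtype.semilatticeInf (P := fun I : Order.Ideal L => IsRegularIdeal I)
    (fun {_ _} (hI : IsRegularIdeal _) (hJ : IsRegularIdeal _) => IsRegularIdeal.inf hI hJ)
  __ := completeLatticeOfSup (StoneCechFrame L) (fun S =>
      ⟨fun I hI => le_sSup (α := Order.Ideal L) ⟨I, hI, rfl⟩,
       fun J hJ => sSup_le (α := Order.Ideal L) (by
         rintro _ ⟨I, hI, rfl⟩
         exact hJ hI)⟩)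

noncomputable instance : Order.Frame (StoneCechFrame L) :=
  Order.Frame.ofMinimalAxioms
    { inf_sSup_le_iSup_inf := fun I S => by
        have h : (sSup S).1 ≤ idealHimp I.1 (⨆ J ∈ S, I ⊓ J).1 := by
          refine sSup_le (α := Order.Ideal L) ?_
          rintro _ ⟨J, hJ, rfl⟩
          rw [le_idealHimp_iff]
          exact le_iSup₂ (f := fun (J : StoneCechFrame L) (_ : J ∈ S) => I ⊓ J) J hJ
        exact le_idealHimp_iff.mp h }

end StoneCech

end PointfreeED

/-!
Everything rests on double pseudocomplements. Since the complemented elements form a base of `L`,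
every `a` is the join of the complemented elements below it, so a least upper bound of those
elements in `CL` can only be `aᶜᶜ`; hence `aᶜᶜ` is complemented as soon as `CL` has enough joins
(`isED_of_exists_isLUB`). Conversely, if `L` is extremally disconnected then `a ↦ aᶜᶜ` lands
in `CL`, is left adjoint to the inclusion, and so provides all joins in `CL`. When `CL`
is complete, its D-ideals are principal, because in a Boolean algebra every subset with a join is
admissible. Conversely, `x ↦ {c ∈ CL : c ≤ x}` is injective and sends `c ∈ CL` to the principal
downset of `c`, so `aᶜᶜ` is complemented as soon as its image is principal.

Both `λL` and `βL` are dense extensions of `L`: taking joins of ideals is a map onto `L` that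
preserves and reflects disjointness and has a right adjoint `r`. Then pseudocomplements in the
extension are the values `r (aᶜ)`, and extremal disconnectedness passes in both directions as long
as `r` takes complementary pairs to covers (`isED_iff_of_dense`).
-/

namespace PointfreeED

/-! ### Complemented elements -/

section Complemented

variable {L : Type u} [Order.Frame L]

theorem _root_.IsComplemented.compl_sup_self {c : L} (hc : IsComplemented c) : cᶜ ⊔ c = ⊤ := by
  obtain ⟨d, hd⟩ := hc
  rw [hd.compl_eq, sup_comm, hd.sup_eq_top]

theorem _root_.IsComplemented.compl_compl_eq {c : L} (hc : IsComplemented c) : cᶜᶜ = c := by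
  obtain ⟨d, hd⟩ := hc
  rw [hd.compl_eq, hd.symm.compl_eq]

theorem _root_.IsComplemented.isComplemented_pseudocompl {c : L} (hc : IsComplemented c) :
    IsComplemented cᶜ := by
  obtain ⟨d, hd⟩ := hc
  exact ⟨c, hd.compl_eq ▸ hd.symm⟩

theorem IsED.isComplemented_compl (h : IsED L) (a : L) : IsComplemented aᶜ :=
  ⟨aᶜᶜ, disjoint_compl_right, codisjoint_iff.mpr (h a)⟩

theorem completelyBelow_of_le_isComplemented {b c x : L} (hc : IsComplemented c) (hb : b ≤ c)
    (hx : c ≤ x) : CompletelyBelow b x :=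
  CompletelyBelow.mono ⟨fun _ => c, rfl, rfl, fun _ _ _ _ _ => hc.compl_sup_self⟩ hb hx

theorem IsCozero.of_isComplemented {c : L} (hc : IsComplemented c) : IsCozero c :=
  ⟨fun _ => c, fun _ => completelyBelow_of_le_isComplemented hc le_rfl le_rfl,
    iSup_const.symm⟩

/-- The Galois connection that witnesses reflectivity of `CL` in an extremally disconnected
frame. -/
theorem IsED.galoisConnection (h : IsED L) :
    GaloisConnection (fun a : L => (⟨aᶜᶜ, h.isComplemented_compl aᶜ⟩ : Complementeds L))
      (fun c : Complementeds L => (c : L)) := fun a c => by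
  refine ⟨fun hac => le_compl_compl.trans hac, fun hac => ?_⟩
  change aᶜᶜ ≤ (c : L)
  rw [← c.2.compl_compl_eq]
  exact compl_le_compl (compl_le_compl hac)

theorem isCompleteBoolean_of_galoisConnection {l : L → Complementeds L}
    (hl : GaloisConnection l (fun c : Complementeds L => (c : L))) :
    IsCompleteBoolean (Complementeds L) := by
  let _ : SupSet (Complementeds L) := ⟨fun S => l (sSup (Subtype.val '' S))⟩
  let C : CompleteLattice (Complementeds L) := completeLatticeOfSup _ fun S =>
    ⟨fun c hc => (le_sSup ⟨c, hc, rfl⟩ : (c : L) ≤ sSup (Subtype.val '' S)).trans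
        (hl.le_u_l _),
      fun c hc => hl.l_le (sSup_le (by
        rintro _ ⟨d, hd, rfl⟩
        exact hc hd))⟩
  exact ⟨Complementeds L,
    { DistribLattice.booleanAlgebraOfComplemented (Complementeds L) with
      sSup := C.sSup
      sInf := C.sInf
      isLUB_sSup := C.isLUB_sSup
      isGLB_sInf := C.isGLB_sInf }, ⟨OrderIso.refl _⟩⟩

theorem IsCompleteBoolean.isFrame {A : Type u} [PartialOrder A] (h : IsCompleteBoolean A) :
    IsFrame A := by
  obtain ⟨B, _, ⟨e⟩⟩ := h
  exact ⟨B, inferInstance, ⟨e⟩⟩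

theorem IsFrame.exists_isLUB {A : Type u} [PartialOrder A] (h : IsFrame A) (S : Set A) :
    ∃ s, IsLUB S s := by
  obtain ⟨F, _, ⟨e⟩⟩ := h
  refine ⟨e.symm (sSup (e '' S)), ?_⟩
  rw [← e.isLUB_image]
  exact isLUB_sSup _

theorem isED_of_isComplemented_compl_compl (h : ∀ a : L, IsComplemented aᶜᶜ) : IsED L :=
  fun a => by simpa using (h a).compl_sup_self

/-- In a zero-dimensional frame, the join in `CL` of the complemented elements below `a` is
`aᶜᶜ`. -/
theorem isED_of_exists_isLUB (hL : IsZeroDimensional L)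
    (h : ∀ S : Set (Complementeds L), ∃ s, IsLUB S s) : IsED L := by
  refine isED_of_isComplemented_compl_compl fun a => ?_
  obtain ⟨s, hs⟩ := h {c | (c : L) ≤ a}
  have has : a ≤ s := (hL a).2 fun c hc => hs.1 (show (⟨c, hc.1⟩ : Complementeds L) ∈ _ from hc.2)
  suffices aᶜᶜ = s from this ▸ s.2
  apply le_antisymm
  · rw [← s.2.compl_compl_eq]
    exact compl_le_compl (compl_le_compl has)
  · rw [le_compl_comm]
    refine (hL aᶜ).2 fun d ⟨hd, hda⟩ => ?_
    -- The complement of `d` in `CL` bounds the complemented elements below `a`, hence also `s`.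
    obtain ⟨d', hd'⟩ := hd
    have hs' : s ≤ (⟨d', d, hd'.symm⟩ : Complementeds L) := hs.2 fun c hc => by
      change (c : L) ≤ d'
      rw [← hd'.compl_eq, le_compl_comm]
      exact hda.trans (compl_le_compl hc)
    rw [le_compl_comm, hd'.compl_eq]
    exact hs'

end Complemented

/-! ### D-ideals -/

section DIdeals

theorem isAdmissibleJoin_of_isLUB {A : Type u} [DistribLattice A] [BoundedOrder A]
    [ComplementedLattice A] {G : Set A} {s : A}
    (h : IsLUB G s) : IsAdmissibleJoin G s := by
  refine ⟨h, fun a => ⟨?_, fun t ht => ?_⟩⟩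
  · rintro _ ⟨y, hy, rfl⟩
    exact inf_le_inf_left a (h.1 hy)
  · obtain ⟨b, hb⟩ := exists_isCompl a
    rw [inf_comm, ← hb.le_sup_right_iff_inf_left_le]
    refine h.2 fun y hy => hb.le_sup_right_iff_inf_left_le.mpr ?_
    rw [inf_comm]
    exact ht ⟨y, hy, rfl⟩

theorem principalDownsets_subset_DInfty (A : Type u) [SemilatticeInf A] :
    principalDownsets A ⊆ DInfty A := by
  rintro _ ⟨a, rfl⟩ G s hG hs
  exact hs.1.2 fun y hy => hG hy

theorem DInfty_subset_principalDownsets {A : Type u} [DistribLattice A] [BoundedOrder A]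
    [ComplementedLattice A] (h : ∀ S : Set A, ∃ s, IsLUB S s) : DInfty A ⊆ principalDownsets A := by
  intro E hE
  obtain ⟨s, hs⟩ := h E
  refine ⟨s, le_antisymm ?_ fun c hc => hs.1 hc⟩
  exact LowerSet.Iic_le.mpr (hE E s subset_rfl (isAdmissibleJoin_of_isLUB hs))

variable {L : Type u} [Order.Frame L]

@[simp]
theorem toDownsets_coe (c : Complementeds L) : toDownsets L c = LowerSet.Iic c := rfl

theorem IsED.image_booleanization (h : IsED L) :
    toDownsets L '' booleanization L = principalDownsets (Complementeds L) := by
  apply Set.Subset.antisymm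
  · rintro _ ⟨x, hx, rfl⟩
    have hc : IsComplemented x := Eq.subst (motive := IsComplemented) hx (h.isComplemented_compl xᶜ)
    exact ⟨⟨x, hc⟩, rfl⟩
  · rintro _ ⟨c, rfl⟩
    exact ⟨c, c.2.compl_compl_eq, rfl⟩

theorem toDownsets_injective (hL : IsZeroDimensional L) : Function.Injective (toDownsets L) := by
  intro x y h
  have hle : ∀ {x y : L}, toDownsets L x = toDownsets L y → x ≤ y := fun {x y} h =>
    (hL x).2 fun c hc =>
      (h.le (show (⟨c, hc.1⟩ : Complementeds L) ∈ toDownsets L x from hc.2) :)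
  exact le_antisymm (hle h) (hle h.symm)

theorem isED_of_image_booleanization_subset (hL : IsZeroDimensional L)
    (h : toDownsets L '' booleanization L ⊆ principalDownsets (Complementeds L)) : IsED L := by
  refine isED_of_isComplemented_compl_compl fun a => ?_
  obtain ⟨c, hc⟩ := h ⟨aᶜᶜ, by simp [booleanization], rfl⟩
  rw [← toDownsets_injective hL ((toDownsets_coe c).trans hc)]
  exact c.2

end DIdeals

/-! ### Dense extensions -/

section Dense

variable {L M : Type u} [Order.Frame L] [Order.Frame M]

/-- Extremal disconnectedness is inherited and reflected by a dense extension `g : M → L` whose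
right adjoint `r` takes complementary pairs to covers. The point is that `xᶜ = r (g x)ᶜ`. -/
theorem isED_iff_of_dense {g : M → L} {r : L → M} (gc : GaloisConnection g r)
    (hgr : ∀ a, g (r a) = a) (hg : ∀ x y, Disjoint x y ↔ Disjoint (g x) (g y))
    (hr : ∀ c, IsComplemented c → r cᶜ ⊔ r c = ⊤) : IsED L ↔ IsED M := by
  have hcompl : ∀ x, xᶜ = r (g x)ᶜ := fun x => eq_of_forall_le_iff fun y => by
    rw [le_compl_iff_disjoint_right, hg, ← le_compl_iff_disjoint_right, gc.le_iff_le]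
  constructor
  · intro h x
    rw [hcompl xᶜ, hcompl x, hgr, sup_comm]
    exact hr _ (h.isComplemented_compl _)
  · intro h a
    have h1 := congrArg g (h (r a))
    rw [hcompl (r a)ᶜ, hcompl (r a), gc.l_sup] at h1
    simp only [hgr] at h1
    rw [h1, eq_top_iff, ← hgr ⊤]
    exact gc.monotone_l le_top

end Dense

/-! ### The Lindelöf coreflection -/

section Lindelof

variable {L : Type u} [Order.Frame L]

/-- The join in `L` of a σ-ideal of cozero elements. -/
def lindelofSup (E : lindelof L) : L := ⨆ c : Coz L, ⨆ _ : c ∈ E.1, (c : L)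

/-- The σ-ideal of the cozero elements below `x`. -/
def lindelofIic (x : L) : lindelof L :=
  ⟨⟨{c : Coz L | (c : L) ≤ x}, fun _ _ h h' => le_trans (Subtype.coe_le_coe.mpr h) h'⟩,
    fun S _ hS c hc => by
      change (c : L) ≤ x
      rw [hc]
      refine sSup_le ?_
      rintro _ ⟨s, hs, rfl⟩
      exact hS hs⟩

theorem mem_lindelofIic {x : L} {c : Coz L} : c ∈ (lindelofIic x).1 ↔ (c : L) ≤ x := Iff.rfl

theorem le_lindelofSup {E : lindelof L} {c : Coz L} (hc : c ∈ E.1) : (c : L) ≤ lindelofSup E :=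
  le_iSup₂ (f := fun (c : Coz L) (_ : c ∈ E.1) => (c : L)) c hc

theorem lindelof_gc : GaloisConnection (lindelofSup (L := L)) lindelofIic := fun _ _ =>
  ⟨fun h _ hc => (le_lindelofSup hc).trans h, fun h => iSup₂_le fun _ hc => h hc⟩

theorem lindelofSup_lindelofIic (hL : IsZeroDimensional L) (a : L) :
    lindelofSup (lindelofIic a) = a :=
  le_antisymm (lindelof_gc.l_u_le a) <| (hL a).2 fun c hc =>
    le_lindelofSup (c := ⟨c, .of_isComplemented hc.1⟩) hc.2

theorem lindelof_bot_mem (E : lindelof L) {c : Coz L} (hc : (c : L) = ⊥) : c ∈ E.1 :=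
  E.2 ∅ Set.countable_empty (Set.empty_subset _) c (by simpa using hc)

theorem lindelof_disjoint_iff (E H : lindelof L) :
    Disjoint E H ↔ Disjoint (lindelofSup E) (lindelofSup H) := by
  constructor
  · intro h
    simp only [lindelofSup, iSup_disjoint_iff, disjoint_iSup_iff]
    intro d hd c hc
    rw [disjoint_iff_inf_le]
    have hle : lindelofIic ((c : L) ⊓ d) ≤ lindelofIic ⊥ := by
      refine le_trans (h ?_ ?_) bot_le
      · exact fun b hb => E.1.lower (show b ≤ c from hb.trans inf_le_left) hc
      · exact fun b hb => H.1.lower (show b ≤ d from hb.trans inf_le_right) hd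
    exact hle (show (⟨(c : L) ⊓ d, c.2.inf d.2⟩ : Coz L) ∈ _ from mem_lindelofIic.mpr le_rfl)
  · intro h K hE hH c hc
    exact lindelof_bot_mem ⊥ (le_bot_iff.mp (h (le_lindelofSup (hE hc)) (le_lindelofSup (hH hc))))

theorem lindelofIic_compl_sup {x : L} (hx : IsComplemented x) :
    lindelofIic xᶜ ⊔ lindelofIic x = ⊤ := by
  rw [eq_top_iff]
  intro c _
  have hx' := hx.isComplemented_pseudocompl
  -- A cozero element `c` is the join of its parts `c ⊓ xᶜ` and `c ⊓ x`.
  let c₁ : Coz L := ⟨c ⊓ xᶜ, c.2.inf (.of_isComplemented hx')⟩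
  let c₂ : Coz L := ⟨c ⊓ x, c.2.inf (.of_isComplemented hx)⟩
  refine (lindelofIic xᶜ ⊔ lindelofIic x).2 {c₁, c₂} (Set.toFinite _).countable ?_ c ?_
  · rintro _ (rfl | rfl)
    · exact (le_sup_left : lindelofIic xᶜ ≤ _) (mem_lindelofIic.mpr inf_le_right)
    · exact (le_sup_right : lindelofIic x ≤ _) (mem_lindelofIic.mpr inf_le_right)
  · rw [Set.image_pair, sSup_pair, ← inf_sup_left, hx.compl_sup_self, inf_top_eq]

theorem isED_iff_isED_lindelof (hL : IsZeroDimensional L) : IsED L ↔ IsED (lindelof L) :=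
  isED_iff_of_dense lindelof_gc (lindelofSup_lindelofIic hL) lindelof_disjoint_iff
    fun _ => lindelofIic_compl_sup

end Lindelof

/-! ### The Stone–Čech compactification -/

section StoneCech

variable {L : Type u} [Order.Frame L]

theorem CompletelyBelow.exists_between {a b : L} (h : CompletelyBelow a b) :
    ∃ d, CompletelyBelow a d ∧ CompletelyBelow d b := by
  obtain ⟨c, rfl, rfl, hc⟩ := h
  refine ⟨c (1 / 2), ⟨fun p => c (p / 2), by simp, rfl, fun p q h0 h1 h2 => ?_⟩,
    ⟨fun p => c ((p + 1) / 2), by simp, by norm_num, fun p q h0 h1 h2 => ?_⟩⟩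
  all_goals exact hc _ _ (by linarith) (by linarith) (by linarith)

/-- The regular ideal of the elements completely below `x`. -/
def regularIdealBelow (x : L) : StoneCechFrame L :=
  ⟨regularPart (Order.Ideal.principal x), fun a ⟨b, hb, hab⟩ => by
    obtain ⟨d, had, hdb⟩ := hab.exists_between
    exact ⟨d, ⟨b, hb, hdb⟩, had⟩⟩

theorem mem_regularIdealBelow {x a : L} : a ∈ (regularIdealBelow x).1 ↔ CompletelyBelow a x :=
  ⟨fun ⟨_, hb, hab⟩ => hab.mono le_rfl hb, fun h => ⟨x, le_rfl, h⟩⟩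

/-- The join in `L` of a regular ideal. -/
def stoneCechSup (I : StoneCechFrame L) : L := ⨆ a : L, ⨆ _ : a ∈ I.1, a

theorem le_stoneCechSup {I : StoneCechFrame L} {a : L} (ha : a ∈ I.1) : a ≤ stoneCechSup I :=
  le_iSup₂ (f := fun (a : L) (_ : a ∈ I.1) => a) a ha

theorem stoneCech_gc : GaloisConnection (stoneCechSup (L := L)) regularIdealBelow := fun I x => by
  refine ⟨fun h a ha => ?_, fun h => iSup₂_le fun a ha => (mem_regularIdealBelow.mp (h ha)).le⟩
  obtain ⟨b, hb, hab⟩ := I.2 a ha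
  exact mem_regularIdealBelow.mpr (hab.mono le_rfl ((le_stoneCechSup hb).trans h))

theorem stoneCechSup_regularIdealBelow (hL : IsZeroDimensional L) (a : L) :
    stoneCechSup (regularIdealBelow a) = a :=
  le_antisymm (stoneCech_gc.l_u_le a) <| (hL a).2 fun _ hc => le_stoneCechSup <|
    mem_regularIdealBelow.mpr (completelyBelow_of_le_isComplemented hc.1 le_rfl hc.2)

theorem stoneCech_disjoint_iff (I J : StoneCechFrame L) :
    Disjoint I J ↔ Disjoint (stoneCechSup I) (stoneCechSup J) := by
  constructor
  · intro h
    simp only [stoneCechSup, iSup_disjoint_iff, disjoint_iSup_iff]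
    intro b hb a ha
    have hle : I ⊓ J ≤ regularIdealBelow ⊥ := h.le_bot.trans bot_le
    have hab : a ⊓ b ∈ (I ⊓ J).1 := ⟨I.1.lower inf_le_left ha, J.1.lower inf_le_right hb⟩
    exact disjoint_iff_inf_le.mpr (mem_regularIdealBelow.mp (hle hab)).le
  · intro h K hI hJ a ha
    rw [le_bot_iff.mp (h (le_stoneCechSup (hI ha)) (le_stoneCechSup (hJ ha)))]
    exact Order.Ideal.bot_mem _

theorem regularIdealBelow_compl_sup {x : L} (hx : IsComplemented x) :
    regularIdealBelow xᶜ ⊔ regularIdealBelow x = ⊤ := by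
  have hx' := hx.isComplemented_pseudocompl
  rw [eq_top_iff]
  intro a _
  -- A complemented element is completely below itself, so the join contains `xᶜ ⊔ x = ⊤`.
  have h₁ : xᶜ ∈ (regularIdealBelow xᶜ ⊔ regularIdealBelow x).1 :=
    (le_sup_left : regularIdealBelow xᶜ ≤ _) <|
      mem_regularIdealBelow.mpr (completelyBelow_of_le_isComplemented hx' le_rfl le_rfl)
  have h₂ : x ∈ (regularIdealBelow xᶜ ⊔ regularIdealBelow x).1 :=
    (le_sup_right : regularIdealBelow x ≤ _) <|
      mem_regularIdealBelow.mpr (completelyBelow_of_le_isComplemented hx le_rfl le_rfl)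
  have h := Order.Ideal.sup_mem h₁ h₂
  rw [hx.compl_sup_self] at h
  exact Order.Ideal.lower _ le_top h

theorem isED_iff_isED_stoneCechFrame (hL : IsZeroDimensional L) :
    IsED L ↔ IsED (StoneCechFrame L) :=
  isED_iff_of_dense stoneCech_gc (stoneCechSup_regularIdealBelow hL) stoneCech_disjoint_iff
    fun _ => regularIdealBelow_compl_sup

end StoneCech

end PointfreeED

/-! ### The equivalences -/

theorem theorem6p5 (L : Type u) [Order.Frame L] (hL : PointfreeED.IsZeroDimensional L) :
    List.TFAE [
      PointfreeED.IsED L,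
      PointfreeED.IsFrame (Complementeds L),
      PointfreeED.principalDownsets (Complementeds L) = PointfreeED.DInfty (Complementeds L) ∧
        PointfreeED.DInfty (Complementeds L) =
          PointfreeED.toDownsets L '' PointfreeED.booleanization L,
      PointfreeED.IsCompleteBoolean (Complementeds L),
      ∃ l : L → Complementeds L, GaloisConnection l (fun c : Complementeds L => (c : L)),
      PointfreeED.IsED (PointfreeED.lindelof L),
      PointfreeED.IsED (PointfreeED.StoneCechFrame L)] := by
  open PointfreeED in
  tfae_have 1 → 5 := fun h => ⟨_, h.galoisConnection⟩
  tfae_have 5 → 4 := fun ⟨_, hl⟩ => isCompleteBoolean_of_galoisConnection hl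
  tfae_have 4 → 2 := IsCompleteBoolean.isFrame
  tfae_have 2 → 1 := fun h => isED_of_exists_isLUB hL h.exists_isLUB
  tfae_have 1 → 3 := fun h => by
    have hlub := (isCompleteBoolean_of_galoisConnection h.galoisConnection).isFrame.exists_isLUB
    have hD := (principalDownsets_subset_DInfty (Complementeds L)).antisymm
      (DInfty_subset_principalDownsets hlub)
    exact ⟨hD, by rw [← hD, h.image_booleanization]⟩
  tfae_have 3 → 1 := fun h =>
    isED_of_image_booleanization_subset hL (h.1.trans h.2).ge
  tfae_have 1 ↔ 6 := isED_iff_isED_lindelof hL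
  tfae_have 1 ↔ 7 := isED_iff_isED_stoneCechFrame hL
  tfae_finish
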